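/- Throughout, all vector spaces over $\mathbb Q$ are finite-dimensional. A (rational) Hodge structure of weight $k\ge 0$ is a $\mathbb Q$-vector space $V$ with a homomorphism $h:\mathbb C^*\to GL(V_{\mathbb R})$ such that $V_{\mathbb C}=\bigoplus_{p+q=k,\ p,q\ge 0}V^{p,q}$, where $V^{p,q}=\{v\in V_{\mathbb C}: h(z)v=z^p\bar z^q v \text{ for all } z\in\mathbb C^*\}$. A polarization of it is a bilinear form $Q:V\times V\to\mathbb Q$ such that $Q(h(z)v,h(z)w)=(z\bar z)^kQ(v,w)$ for all $z\in\mathbb C^*$, $v,w\in V_{\mathbb R}$, and such that $Q(v,h(i)w)$ is a symmetric and positive definite form on $V_{\mathbb R}$. The Mumford–Tate group $MT(V)$ is the smallest algebraic subgroup $G$ of $GL(V)$ defined over $\mathbb Q$ with $h(\mathbb C^*)\subset G(\mathbb R)$. Let $GO(Q)$ be the algebraic group of all $g\in GL(V)$ such that $Q(gv,gw)=\nu(g)Q(v,w)$ for some $\nu(g)\in\mathbb G_m$, and let $\mathbb G_m\cdot SO(Q)\subset GO(Q)$ be its subgroup of products of scalars and elements of the special orthogonal group. **Proposition 4.2.**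 Let $(V,h,Q)$ be a polarized Hodge structure of weight two with $\dim V^{2,0}>0$ and with $MT(V)=GO(Q)$ or $MT(V)=\mathbb G_m\cdot SO(Q)$. (The two groups are equal if $\dim V$ is odd; if $\dim V$ is even, $\mathbb G_m\cdot SO(Q)$ is the identity component of $GO(Q)$.) Let $(W,h_W)$ be a Hodge structure of weight one, and give $W\otimes W$ the Hodge structure $h_W\otimes h_W$. If there is an injective $\mathbb Q$-linear map $f:V\to W\otimes W$ which is a morphism of Hodge structures, that is, $f(h(z)v)=(h_W(z)\otimes h_W(z))f(v)$ for all $z\in\mathbb C^*$ and $v\in V_{\mathbb R}$, then $\dim V^{2,0}=1$. -/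

import Mathlib

open scoped TensorProduct

namespace Hodge

noncomputable section

universe u v

/-- The real vector space `V_ℝ = V ⊗_ℚ ℝ`. -/
abbrev RealPoints (V : Type u) [AddCommGroup V] [Module ℚ V] : Type u := ℝ ⊗[ℚ] V

/-- The complex vector space `V_ℂ = V ⊗_ℚ ℂ`. -/
abbrev ComplexPoints (V : Type u) [AddCommGroup V] [Module ℚ V] : Type u := ℂ ⊗[ℚ] V

/-- `GL(V)(ℝ) = GL(V_ℝ)`. -/
abbrev GLReal (V : Type u) [AddCommGroup V] [Module ℚ V] : Type u :=
  RealPoints V ≃ₗ[ℝ] RealPoints V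

/-- `GL(V)(ℂ) = GL(V_ℂ)`. -/
abbrev GLComplex (V : Type u) [AddCommGroup V] [Module ℚ V] : Type u :=
  ComplexPoints V ≃ₗ[ℂ] ComplexPoints V

section Structures

variable {V : Type u} [AddCommGroup V] [Module ℚ V]
variable {W : Type v} [AddCommGroup W] [Module ℚ W]

/-- The inclusion `GL(V_ℝ) ⊆ GL(V_ℂ)`: the complex linear extension of `g`, transported along
the canonical isomorphism `ℂ ⊗_ℝ (ℝ ⊗_ℚ V) ≃ ℂ ⊗_ℚ V`. -/
def complexify (g : GLReal V) : GLComplex V :=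
  (TensorProduct.AlgebraTensorModule.cancelBaseChange ℚ ℝ ℂ ℂ V).symm ≪≫ₗ
    (g.baseChange ℝ ℂ _ _) ≪≫ₗ
    TensorProduct.AlgebraTensorModule.cancelBaseChange ℚ ℝ ℂ ℂ V

/-- For a homomorphism `h : ℂ* → GL(V_ℝ)`, the subspace
`V^{p,q} = {v ∈ V_ℂ : h(z) v = z^p z̄^q v for all z ∈ ℂ*}` of `V_ℂ`. -/
def hodgePart (h : ℂˣ →* GLReal V) (p q : ℕ) : Submodule ℂ (ComplexPoints V) where
  carrier := {v | ∀ z : ℂˣ, complexify (h z) v =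
    ((z : ℂ) ^ p * (starRingEnd ℂ (z : ℂ)) ^ q) • v}
  add_mem' := by
    intro a b ha hb z
    rw [map_add, ha z, hb z, smul_add]
  zero_mem' := by
    intro z
    rw [map_zero, smul_zero]
  smul_mem' := by
    intro c a ha z
    rw [map_smul, ha z, smul_comm]

/-- `(V, h)` is a rational Hodge structure of weight `k`, with `p, q ≥ 0`:
`V_ℂ` is the direct sum of the subspaces `V^{p,q}`, where `p, q ≥ 0` and `p + q = k`.
The symmetry of the decomposition under complex conjugation is automatic, because
each `h(z)` is defined over `ℝ`; conversely every Hodge decomposition of weight `k` comes from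
exactly one such `h`. -/
def IsHodgeStructure (h : ℂˣ →* GLReal V) (k : ℕ) : Prop :=
  DirectSum.IsInternal (fun pq : {pq : ℕ × ℕ // pq.1 + pq.2 = k} => hodgePart h pq.1.1 pq.1.2)

/-- The unit `i ∈ ℂ*`. -/
def unitI : ℂˣ := Units.mk0 Complex.I Complex.I_ne_zero

/-- `Ψ` is a polarization of the Hodge structure `(V, h)` of weight `k`:
`Ψ(h(z)v, h(z)w) = (z z̄)^k Ψ(v, w)`, and `Ψ(v, h(i)w)` is a symmetric and positive definite
form on `V_ℝ`. -/
structure IsPolarization (h : ℂˣ →* GLReal V) (k : ℕ) (Ψ : LinearMap.BilinForm ℚ V) : Prop where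
  equivariant : ∀ (z : ℂˣ) (v w : RealPoints V),
    Ψ.baseChange ℝ (h z v) (h z w) = Complex.normSq (z : ℂ) ^ k * Ψ.baseChange ℝ v w
  symm : ∀ v w : RealPoints V,
    Ψ.baseChange ℝ v (h unitI w) = Ψ.baseChange ℝ w (h unitI v)
  pos : ∀ v : RealPoints V, v ≠ 0 → 0 < Ψ.baseChange ℝ v (h unitI v)

/-- The canonical isomorphism `(V ⊗ W)_ℝ ≃ V_ℝ ⊗_ℝ W_ℝ`. -/
def realTensorEquiv (V : Type u) [AddCommGroup V] [Module ℚ V]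
    (W : Type v) [AddCommGroup W] [Module ℚ W] :
    RealPoints (V ⊗[ℚ] W) ≃ₗ[ℝ] RealPoints V ⊗[ℝ] RealPoints W :=
  TensorProduct.AlgebraTensorModule.distribBaseChange ℚ ℝ V W

/-- The tensor product of Hodge structures: `h_V ⊗ h_W` sends `z` to the automorphism
`v ⊗ w ↦ (h_V(z) v) ⊗ (h_W(z) w)` of `(V ⊗ W)_ℝ`. -/
def tensor (hV : ℂˣ →* GLReal V) (hW : ℂˣ →* GLReal W) : ℂˣ →* GLReal (V ⊗[ℚ] W) where
  toFun z := realTensorEquiv V W ≪≫ₗ TensorProduct.congr (hV z) (hW z) ≪≫ₗ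
    (realTensorEquiv V W).symm
  map_one' := by
    apply LinearEquiv.ext
    intro x
    have h1 : TensorProduct.congr (1 : GLReal V) (1 : GLReal W) = LinearEquiv.refl ℝ _ :=
      TensorProduct.congr_refl_refl
    simp only [map_one, h1, LinearEquiv.trans_apply, LinearEquiv.refl_apply,
      LinearEquiv.symm_apply_apply, LinearEquiv.coe_one, id_eq]
  map_mul' := by
    intro y z
    apply LinearEquiv.ext
    intro x
    simp only [map_mul, TensorProduct.congr_mul, LinearEquiv.trans_apply, LinearEquiv.mul_apply,
      LinearEquiv.apply_symm_apply]

/-- A rational linear map `f : V → W` is a (strict) morphism of Hodge structures if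
`f(h_V(z) v) = h_W(z) f(v)` for all `z ∈ ℂ*` and `v ∈ V_ℝ`. -/
def IsHodgeMorphism (hV : ℂˣ →* GLReal V) (hW : ℂˣ →* GLReal W) (f : V →ₗ[ℚ] W) : Prop :=
  ∀ (z : ℂˣ) (v : RealPoints V), f.baseChange ℝ (hV z v) = hW z (f.baseChange ℝ v)

end Structures

section Groups

variable {V : Type u} [AddCommGroup V] [Module ℚ V]

/-- The matrix of `g ∈ GL(V_ℂ)` with respect to a `ℚ`-basis of `V`. -/
def rationalMatrix [FiniteDimensional ℚ V] (g : GLComplex V) :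
    Matrix (Fin (Module.finrank ℚ V)) (Fin (Module.finrank ℚ V)) ℂ :=
  LinearMap.toMatrix ((Module.finBasis ℚ V).baseChange ℂ) ((Module.finBasis ℚ V).baseChange ℂ)
    (g : ComplexPoints V →ₗ[ℂ] ComplexPoints V)

/-- A subgroup `G ⊆ GL(V_ℂ)` is (the group of complex points of) an algebraic subgroup of `GL(V)`
defined over `ℚ` if it is cut out in `GL(V_ℂ)` by polynomial equations with coefficients in `ℚ`
in the matrix entries with respect to a `ℚ`-basis of `V`. (Allowing `det(g)⁻¹` in the equations
gives nothing more, since one can multiply by a power of `det(g)`; and in characteristic zero an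
algebraic subgroup is determined by its complex points.) -/
def IsAlgebraicOverRat [FiniteDimensional ℚ V] (G : Subgroup (GLComplex V)) : Prop :=
  ∃ S : Set (MvPolynomial (Fin (Module.finrank ℚ V) × Fin (Module.finrank ℚ V)) ℚ),
    ∀ g : GLComplex V, g ∈ G ↔
      ∀ F ∈ S, MvPolynomial.aeval (fun ij => rationalMatrix g ij.1 ij.2) F = 0

/-- The Mumford-Tate group (its group of complex points): the smallest algebraic subgroup `G` of
`GL(V)` defined over `ℚ` such that `h(ℂ*) ⊆ G(ℝ)`; here `G(ℝ) = GL(V_ℝ) ∩ G(ℂ)`. -/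
def mumfordTate [FiniteDimensional ℚ V] (h : ℂˣ →* GLReal V) : Subgroup (GLComplex V) :=
  sInf {G | IsAlgebraicOverRat G ∧ ∀ z : ℂˣ, complexify (h z) ∈ G}

/-- The group of orthogonal similitudes `GO(Q)` (its complex points): the `g ∈ GL(V_ℂ)` with
`Q(gv, gw) = ν(g) Q(v, w)` for some `ν(g) ∈ ℂ*`. -/
def GO (Q : LinearMap.BilinForm ℚ V) : Subgroup (GLComplex V) where
  carrier := {g | ∃ ν : ℂˣ, ∀ v w : ComplexPoints V,
    Q.baseChange ℂ (g v) (g w) = (ν : ℂ) * Q.baseChange ℂ v w}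
  one_mem' := ⟨1, by intro v w; simp⟩
  mul_mem' := by
    rintro a b ⟨α, ha⟩ ⟨β, hb⟩
    refine ⟨α * β, fun v w => ?_⟩
    rw [LinearEquiv.mul_apply, LinearEquiv.mul_apply, ha, hb, Units.val_mul, mul_assoc]
  inv_mem' := by
    rintro a ⟨α, ha⟩
    refine ⟨α⁻¹, fun v w => ?_⟩
    have h1 : ∀ x, a (a⁻¹ x) = x := fun x => LinearEquiv.apply_symm_apply a x
    have h2 := ha (a⁻¹ v) (a⁻¹ w)
    rw [h1, h1] at h2
    rw [h2, Units.inv_mul_cancel_left]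

/-- The special orthogonal group `SO(Q)` (its complex points). -/
def SO (Q : LinearMap.BilinForm ℚ V) : Subgroup (GLComplex V) where
  carrier := {g | (∀ v w : ComplexPoints V,
    Q.baseChange ℂ (g v) (g w) = Q.baseChange ℂ v w) ∧ LinearEquiv.det g = 1}
  one_mem' := ⟨by intro v w; simp, map_one _⟩
  mul_mem' := by
    rintro a b ⟨ha, ha'⟩ ⟨hb, hb'⟩
    refine ⟨fun v w => ?_, by rw [map_mul, ha', hb', one_mul]⟩
    rw [LinearEquiv.mul_apply, LinearEquiv.mul_apply, ha, hb]
  inv_mem' := by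
    rintro a ⟨ha, ha'⟩
    refine ⟨fun v w => ?_, by rw [map_inv, ha', inv_one]⟩
    have h1 : ∀ x, a (a⁻¹ x) = x := fun x => LinearEquiv.apply_symm_apply a x
    have h2 := ha (a⁻¹ v) (a⁻¹ w)
    rw [h1, h1] at h2
    exact h2.symm

/-- The group `𝔾_m · SO(Q)` (its complex points): the products `c • s` with `c ∈ ℂ*` and
`s ∈ SO(Q)(ℂ)`. For non-degenerate symmetric `Q` on `V ≠ 0` it is the identity component
of `GO(Q)`; it is equal to `GO(Q)` if `dim V` is odd and has index two in it if `dim V` is even. -/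
def GSO (Q : LinearMap.BilinForm ℚ V) : Subgroup (GLComplex V) where
  carrier := {g | ∃ c : ℂˣ, ∃ s ∈ SO Q, ∀ v : ComplexPoints V, g v = (c : ℂ) • s v}
  one_mem' := ⟨1, 1, one_mem _, by intro v; simp⟩
  mul_mem' := by
    rintro a b ⟨c, s, hs, ha⟩ ⟨d, t, ht, hb⟩
    refine ⟨c * d, s * t, mul_mem hs ht, fun v => ?_⟩
    rw [LinearEquiv.mul_apply, LinearEquiv.mul_apply, ha, hb, map_smul, smul_smul, Units.val_mul]
  inv_mem' := by
    rintro a ⟨c, s, hs, ha⟩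
    refine ⟨c⁻¹, s⁻¹, inv_mem hs, fun v => ?_⟩
    have h1 : a (((c⁻¹ : ℂˣ) : ℂ) • s⁻¹ v) = v := by
      have h2 : s (s⁻¹ v) = v := LinearEquiv.apply_symm_apply s v
      rw [ha, map_smul, h2, smul_smul, Units.mul_inv, one_smul]
    exact (LinearEquiv.symm_apply_eq a).2 h1.symm

end Groups

end

end Hodge

/-! Let `inducedEnd f` consist of the endomorphisms of `V_ℂ` that correspond, through `f`, to
derivations `A ⊗ 1 + 1 ⊗ A` of `W_ℂ ⊗ W_ℂ`. As `f` is rational, this subspace is defined over `ℚ`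
(`baseChange_contractEnd_mem_inducedEnd`), so its normalizer in `GL(V_ℂ)` is algebraic over `ℚ`. As
`f` is a morphism of Hodge structures, the normalizer contains `h(ℂ*)`. It therefore contains the
Mumford–Tate group (`mumfordTate_le_matrixNormalizer`), and in particular `SO(Q)`.

The operator `μ` acting as `p` on `V^{p,q}` lies in `inducedEnd f`: it is induced by the projection
of `W_ℂ` onto `W^{1,0}`. An idempotent has `ad`-eigenvalues in `{0, 1, -1}`, so by injectivity of
`f` the identity `(ad μ)³ = ad μ` holds on `inducedEnd f` (`ad_pow_three_of_mem_inducedEnd`).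

If `V^{2,0}` contained independent vectors `e₁, e₂`, they would span an isotropic plane, and `x =
Q(e₁, ·)e₂ - Q(e₂, ·)e₁` would satisfy `x² = 0`, `1 + x ∈ SO(Q)` and `[μ, x] = 2x`. Conjugating `μ`
by `1 + x` puts `μ - 2x` in `inducedEnd f`, which has no room for weight 2. Hence `x = 0`,
contradicting nondegeneracy of `Q`. -/

namespace Hodge

noncomputable section

universe u v w

/-! ### Complex matrix subspaces defined over `ℚ`, and their linear equations. -/

section RationalSubspaces

variable {n : Type*}

/-- The image of a complex matrix under a `ℚ`-linear functional, applied entrywise. -/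
def ratPart (l : ℂ →ₗ[ℚ] ℚ) (M : Matrix n n ℂ) : Matrix n n ℚ := M.map l

/-- A complex subspace of matrices is rational if it is stable under all
`ℚ`-linear functionals `ℂ → ℚ ⊆ ℂ`, applied entrywise. -/
def IsRationalSubspace (S : Submodule ℂ (Matrix n n ℂ)) : Prop :=
  ∀ (l : ℂ →ₗ[ℚ] ℚ), ∀ M ∈ S, (ratPart l M).map (algebraMap ℚ ℂ) ∈ S

/-- Expand each entry in a `ℚ`-basis of `ℂ`; the finitely many entries involve only finitely many
basis elements. -/
theorem exists_eq_sum_ratPart [Fintype n] (M : Matrix n n ℂ) :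
    ∃ (K : Finset (Module.Basis.ofVectorSpaceIndex ℚ ℂ)),
      M = ∑ k ∈ K, (k : ℂ) •
        (ratPart ((Module.Basis.ofVectorSpace ℚ ℂ).coord k) M).map (algebraMap ℚ ℂ) := by
  classical
  let β := Module.Basis.ofVectorSpace ℚ ℂ
  refine ⟨Finset.univ.biUnion fun ij : n × n => (β.repr (M ij.1 ij.2)).support, ?_⟩
  ext i j
  conv_lhs => rw [← β.linearCombination_repr (M i j)]
  rw [Finsupp.linearCombination_apply, Finsupp.sum_of_support_subset
    (s := Finset.univ.biUnion fun ij : n × n => (β.repr (M ij.1 ij.2)).support)]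
  · simp only [Matrix.sum_apply, Matrix.smul_apply, Matrix.map_apply, ratPart]
    refine Finset.sum_congr rfl fun k _ => ?_
    rw [Module.Basis.coord_apply, Module.Basis.ofVectorSpace_apply_self, Algebra.smul_def,
      smul_eq_mul, mul_comm]
  · intro k hk
    exact Finset.mem_biUnion.2 ⟨(i, j), Finset.mem_univ _, hk⟩
  · intro k _
    simp

theorem IsRationalSubspace.mem_span [Fintype n] {S : Submodule ℂ (Matrix n n ℂ)} (hS : IsRationalSubspace S)
    {M : Matrix n n ℂ} (hM : M ∈ S) :
    M ∈ Submodule.span ℂ {N | ∃ Y : Matrix n n ℚ, N = Y.map (algebraMap ℚ ℂ) ∧ N ∈ S} := by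
  obtain ⟨K, hK⟩ := exists_eq_sum_ratPart M
  rw [hK]
  exact Submodule.sum_mem _ fun k _ => Submodule.smul_mem _ _
    (Submodule.subset_span ⟨_, rfl, hS _ _ hM⟩)

/-- The rational points of a complex subspace of matrices. -/
def rationalPoints (S : Submodule ℂ (Matrix n n ℂ)) : Submodule ℚ (Matrix n n ℚ) :=
  (S.restrictScalars ℚ).comap ((Algebra.linearMap ℚ ℂ).mapMatrix)

theorem mem_rationalPoints {S : Submodule ℂ (Matrix n n ℂ)} {Y : Matrix n n ℚ} :
    Y ∈ rationalPoints S ↔ Y.map (algebraMap ℚ ℂ) ∈ S := Iff.rfl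

/-- The coefficient matrices of the rational linear equations of a subspace. -/
def equations [Fintype n] (S : Submodule ℂ (Matrix n n ℂ)) : Set (Matrix n n ℚ) :=
  {c | ∀ Y ∈ rationalPoints S, ∑ i, ∑ j, c i j * Y i j = 0}

/-- A rational equation commutes with every functional `ℂ → ℚ`, and these functionals separate the
points of `ℂ`. Conversely, if some rational part of `M` were outside the rational points, a
functional on rational matrices would separate it from them, and its coefficients would be an
equation violated by `M`. -/
theorem IsRationalSubspace.mem_iff [Fintype n] {S : Submodule ℂ (Matrix n n ℂ)} (hS : IsRationalSubspace S)
    {M : Matrix n n ℂ} :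
    M ∈ S ↔ ∀ c ∈ equations S, ∑ i, ∑ j, algebraMap ℚ ℂ (c i j) * M i j = 0 := by
  classical
  have key : ∀ (l : ℂ →ₗ[ℚ] ℚ) (c : Matrix n n ℚ),
      l (∑ i, ∑ j, algebraMap ℚ ℂ (c i j) * M i j) = ∑ i, ∑ j, c i j * ratPart l M i j := by
    intro l c
    simp only [map_sum, ← Algebra.smul_def, map_smul, smul_eq_mul, ratPart, Matrix.map_apply]
  constructor
  · intro hM c hc
    refine (Module.forall_dual_apply_eq_zero_iff ℚ _).1 fun l => ?_
    rw [key]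
    exact hc _ (hS l M hM)
  · intro h
    obtain ⟨K, hK⟩ := exists_eq_sum_ratPart M
    rw [hK]
    refine Submodule.sum_mem _ fun k _ => Submodule.smul_mem _ _ ?_
    generalize (Module.Basis.ofVectorSpace ℚ ℂ).coord k = l
    rw [← mem_rationalPoints]
    by_contra hl
    obtain ⟨φ, hφ, hφ'⟩ := Submodule.exists_le_ker_of_notMem hl
    have hφs : ∀ Y : Matrix n n ℚ, φ Y = ∑ i, ∑ j, φ (Matrix.single i j 1) * Y i j := by
      intro Y
      conv_lhs => rw [Matrix.matrix_eq_sum_single Y]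
      simp only [map_sum]
      refine Finset.sum_congr rfl fun i _ => Finset.sum_congr rfl fun j _ => ?_
      rw [mul_comm, ← smul_eq_mul, ← map_smul, Matrix.smul_single, smul_eq_mul, mul_one]
    apply hφ
    rw [hφs]
    refine (key l (Matrix.of fun i j => φ (Matrix.single i j 1))).symm.trans ?_
    rw [h _ fun Y hY => ?_, map_zero]
    exact (hφs Y).symm.trans (hφ' hY)

end RationalSubspaces

/-! ### The normalizer of a rational subspace is algebraic over `ℚ`. -/

section Normalizer

variable {V : Type u} [AddCommGroup V] [Module ℚ V] [FiniteDimensional ℚ V]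

theorem rationalMatrix_mul (g k : GLComplex V) :
    rationalMatrix (g * k) = rationalMatrix g * rationalMatrix k :=
  LinearMap.toMatrix_mul _ _ _

theorem rationalMatrix_one : rationalMatrix (1 : GLComplex V) = 1 :=
  LinearMap.toMatrix_one _

theorem rationalMatrix_mul_inv (g : GLComplex V) :
    rationalMatrix g * rationalMatrix g⁻¹ = 1 := by
  rw [← rationalMatrix_mul, mul_inv_cancel, rationalMatrix_one]

theorem isUnit_det_rationalMatrix (g : GLComplex V) : IsUnit (rationalMatrix g).det :=
  Matrix.isUnit_det_of_right_inverse (rationalMatrix_mul_inv g)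

theorem rationalMatrix_inv (g : GLComplex V) :
    rationalMatrix g⁻¹ = (rationalMatrix g).det⁻¹ • (rationalMatrix g).adjugate := by
  rw [← Matrix.inv_eq_right_inv (rationalMatrix_mul_inv g), Matrix.inv_def,
    Ring.inverse_eq_inv']

/-- The normalizer in `GL(V_ℂ)` of a subspace of matrices. -/
def matrixNormalizer
    (S : Submodule ℂ (Matrix (Fin (Module.finrank ℚ V)) (Fin (Module.finrank ℚ V)) ℂ)) :
    Subgroup (GLComplex V) where
  carrier := {g | ∀ M ∈ S, rationalMatrix g * M * rationalMatrix g⁻¹ ∈ S ∧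
    rationalMatrix g⁻¹ * M * rationalMatrix g ∈ S}
  one_mem' := by
    intro M hM
    simpa [rationalMatrix_one] using hM
  mul_mem' := by
    intro a b ha hb M hM
    have h1 := (ha _ (hb _ hM).1).1
    have h2 := (hb _ (ha _ hM).2).2
    simp only [mul_inv_rev, rationalMatrix_mul]
    simp only [mul_assoc] at h1 h2 ⊢
    exact ⟨h1, h2⟩
  inv_mem' := by
    intro a ha M hM
    rw [inv_inv]
    exact (ha M hM).symm

/-- The polynomials expressing `∑ c i j (X Y adj X) i j = 0` (for `b = true`), resp.
`∑ c i j (adj X Y X) i j = 0`. -/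
def conjPolynomial {n : Type*} [Fintype n] [DecidableEq n] (b : Bool) (c Y : Matrix n n ℚ) :
    MvPolynomial (n × n) ℚ :=
  ∑ i, ∑ j, algebraMap ℚ _ (c i j) *
    (if b then Matrix.mvPolynomialX n n ℚ * Y.map (algebraMap ℚ _) *
        (Matrix.mvPolynomialX n n ℚ).adjugate
      else (Matrix.mvPolynomialX n n ℚ).adjugate * Y.map (algebraMap ℚ _) *
        Matrix.mvPolynomialX n n ℚ : Matrix n n (MvPolynomial (n × n) ℚ)) i j

theorem aeval_conjPolynomial {n : Type*} [Fintype n] [DecidableEq n] (b : Bool)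
    (c Y : Matrix n n ℚ) (P : Matrix n n ℂ) :
    MvPolynomial.aeval (fun ij : n × n => P ij.1 ij.2) (conjPolynomial b c Y) =
      ∑ i, ∑ j, algebraMap ℚ ℂ (c i j) *
        (if b then P * Y.map (algebraMap ℚ ℂ) * P.adjugate
          else P.adjugate * Y.map (algebraMap ℚ ℂ) * P : Matrix n n ℂ) i j := by
  let φ : MvPolynomial (n × n) ℚ →ₐ[ℚ] ℂ := MvPolynomial.aeval (fun ij : n × n => P ij.1 ij.2)
  have hX : φ.mapMatrix (Matrix.mvPolynomialX n n ℚ) = P :=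
    Matrix.mvPolynomialX_mapMatrix_aeval ℚ P
  have hA : φ.mapMatrix (Matrix.mvPolynomialX n n ℚ).adjugate = P.adjugate := by
    rw [AlgHom.map_adjugate, hX]
  have hY : φ.mapMatrix (Y.map (algebraMap ℚ _)) = Y.map (algebraMap ℚ ℂ) := by
    ext i j
    simp
  have hφ : ∀ (N : Matrix n n (MvPolynomial (n × n) ℚ)) i j, φ (N i j) = φ.mapMatrix N i j :=
    fun _ _ _ => rfl
  change φ _ = _
  simp only [conjPolynomial, map_sum, map_mul, AlgHom.commutes]
  refine Finset.sum_congr rfl fun i _ => Finset.sum_congr rfl fun j _ => ?_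
  rw [hφ]
  cases b
  · simp only [Bool.false_eq_true, if_false, map_mul, hX, hA, hY]
  · simp only [if_true, map_mul, hX, hA, hY]

/-- The condition need only be tested on rational matrices, which span `S`, against the rational
equations of `S`. Replacing the inverse by the adjugate changes the conjugate by a nonzero scalar
and makes the conditions polynomial. -/
theorem isAlgebraicOverRat_matrixNormalizer
    {S : Submodule ℂ (Matrix (Fin (Module.finrank ℚ V)) (Fin (Module.finrank ℚ V)) ℂ)}
    (hS : IsRationalSubspace S) : IsAlgebraicOverRat (matrixNormalizer (V := V) S) := by
  refine ⟨{F | ∃ b, ∃ c ∈ equations S, ∃ Y ∈ rationalPoints S, F = conjPolynomial b c Y},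
    fun g => ?_⟩
  set P := rationalMatrix g with hP
  have hd : (P.det)⁻¹ ≠ 0 := inv_ne_zero (isUnit_det_rationalMatrix g).ne_zero
  have hinv : rationalMatrix g⁻¹ = P.det⁻¹ • P.adjugate := rationalMatrix_inv g
  have h1 : ∀ M, P * M * rationalMatrix g⁻¹ ∈ S ↔ P * M * P.adjugate ∈ S := by
    intro M
    rw [hinv, Matrix.mul_smul, Submodule.smul_mem_iff _ hd]
  have h2 : ∀ M, rationalMatrix g⁻¹ * M * P ∈ S ↔ P.adjugate * M * P ∈ S := by
    intro M
    rw [hinv, Matrix.smul_mul, Matrix.smul_mul, Submodule.smul_mem_iff _ hd]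
  constructor
  · rintro hg F ⟨b, c, hc, Y, hY, rfl⟩
    rw [aeval_conjPolynomial]
    have h3 := hg _ hY
    refine hS.mem_iff.1 ?_ c hc
    cases b
    · exact (h2 _).1 h3.2
    · exact (h1 _).1 h3.1
  · intro hF M hM
    replace hM := hS.mem_span hM
    induction hM using Submodule.span_induction with
    | mem N hN =>
      obtain ⟨Y, rfl, hY⟩ := hN
      refine ⟨(h1 _).2 (hS.mem_iff.2 fun c hc => ?_), (h2 _).2 (hS.mem_iff.2 fun c hc => ?_)⟩
      · have := hF _ ⟨true, c, hc, Y, hY, rfl⟩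
        rw [aeval_conjPolynomial] at this
        exact this
      · have := hF _ ⟨false, c, hc, Y, hY, rfl⟩
        rw [aeval_conjPolynomial] at this
        exact this
    | zero => simp
    | add x y _ _ hx hy =>
      simp only [mul_add, add_mul]
      exact ⟨add_mem hx.1 hy.1, add_mem hx.2 hy.2⟩
    | smul a x _ hx =>
      simp only [Matrix.mul_smul, Matrix.smul_mul]
      exact ⟨S.smul_mem a hx.1, S.smul_mem a hx.2⟩

end Normalizer

/-! ### Passage from `V_ℝ` to `V_ℂ`. -/

section ComplexPoints

variable {V : Type u} [AddCommGroup V] [Module ℚ V]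
variable {W : Type v} [AddCommGroup W] [Module ℚ W]

/-- The inclusion `V_ℝ → V_ℂ`. -/
def realToComplex (V : Type u) [AddCommGroup V] [Module ℚ V] :
    RealPoints V →ₗ[ℝ] ComplexPoints V :=
  (TensorProduct.AlgebraTensorModule.cancelBaseChange ℚ ℝ ℂ ℂ V).toLinearMap.restrictScalars ℝ ∘ₗ
    TensorProduct.mk ℝ ℂ (RealPoints V) 1

theorem realToComplex_tmul (r : ℝ) (v : V) :
    realToComplex V (r ⊗ₜ v) = (r : ℂ) ⊗ₜ[ℚ] v := by
  simp [realToComplex]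

theorem complexify_realToComplex (g : GLReal V) (x : RealPoints V) :
    complexify g (realToComplex V x) = realToComplex V (g x) := by
  simp [realToComplex, complexify]

/-- `V_ℝ` spans `V_ℂ` over `ℂ`; identities known on real points are transferred to complex points
this way. -/
theorem ext_realToComplex {M : Type w} [AddCommGroup M] [Module ℂ M]
    {f g : ComplexPoints V →ₗ[ℂ] M}
    (h : ∀ x, f (realToComplex V x) = g (realToComplex V x)) : f = g := by
  refine LinearMap.ext fun x => ?_
  induction x using TensorProduct.induction_on with
  | zero => simp
  | add x y hx hy => rw [map_add, map_add, hx, hy]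
  | tmul c v =>
    have h1 : c ⊗ₜ[ℚ] v = c • realToComplex V (1 ⊗ₜ v) := by
      simp [realToComplex_tmul, TensorProduct.smul_tmul']
    rw [h1, map_smul, map_smul, h]

theorem complexify_mul (g k : GLReal V) : complexify (g * k) = complexify g * complexify k := by
  apply LinearEquiv.toLinearMap_injective
  refine ext_realToComplex fun x => ?_
  simp [complexify_realToComplex]

theorem complexify_one : complexify (1 : GLReal V) = 1 := by
  apply LinearEquiv.toLinearMap_injective
  refine ext_realToComplex fun x => ?_
  simp [complexify_realToComplex]

/-- The complexification of `h : ℂ* → GL(V_ℝ)`. -/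
def complexHom (h : ℂˣ →* GLReal V) : ℂˣ →* GLComplex V where
  toFun z := complexify (h z)
  map_one' := by rw [map_one, complexify_one]
  map_mul' y z := by rw [map_mul, complexify_mul]

theorem complexHom_apply (h : ℂˣ →* GLReal V) (z : ℂˣ) : complexHom h z = complexify (h z) := rfl

theorem baseChange_realToComplex (Q : LinearMap.BilinForm ℚ V) (x y : RealPoints V) :
    Q.baseChange ℂ (realToComplex V x) (realToComplex V y) = (Q.baseChange ℝ x y : ℝ) := by
  induction x using TensorProduct.induction_on with
  | zero => simp
  | add x x' hx hx' => simp [hx, hx']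
  | tmul r v =>
    induction y using TensorProduct.induction_on with
    | zero => simp
    | add y y' hy hy' => simp [hy, hy']
    | tmul s w => simp [realToComplex_tmul, Rat.smul_def]

theorem linearMap_baseChange_realToComplex (f : V →ₗ[ℚ] W) (x : RealPoints V) :
    f.baseChange ℂ (realToComplex V x) = realToComplex W (f.baseChange ℝ x) := by
  induction x using TensorProduct.induction_on with
  | zero => simp
  | add x x' hx hx' => simp [hx, hx']
  | tmul r v => simp [realToComplex_tmul]

/-- The canonical isomorphism `(V ⊗ W)_ℂ ≃ V_ℂ ⊗_ℂ W_ℂ`. -/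
def complexTensorEquiv (V : Type u) [AddCommGroup V] [Module ℚ V]
    (W : Type v) [AddCommGroup W] [Module ℚ W] :
    ComplexPoints (V ⊗[ℚ] W) ≃ₗ[ℂ] ComplexPoints V ⊗[ℂ] ComplexPoints W :=
  TensorProduct.AlgebraTensorModule.distribBaseChange ℚ ℂ V W

theorem complexTensorEquiv_tmul (c : ℂ) (v : V) (w : W) :
    complexTensorEquiv V W (c ⊗ₜ (v ⊗ₜ w)) = (c ⊗ₜ v) ⊗ₜ (1 ⊗ₜ w) := rfl

theorem complexTensorEquiv_realToComplex (x : RealPoints V) (y : RealPoints W) :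
    complexTensorEquiv V W (realToComplex _ ((realTensorEquiv V W).symm (x ⊗ₜ y))) =
      realToComplex V x ⊗ₜ realToComplex W y := by
  induction x using TensorProduct.induction_on with
  | zero => simp
  | add x x' hx hx' => simp only [TensorProduct.add_tmul, map_add, hx, hx']
  | tmul r v =>
    induction y using TensorProduct.induction_on with
    | zero => simp
    | add y y' hy hy' => simp only [TensorProduct.tmul_add, map_add, hy, hy']
    | tmul s w =>
      rw [realTensorEquiv, TensorProduct.AlgebraTensorModule.distribBaseChange_symm_tmul,
        realToComplex_tmul, complexTensorEquiv_tmul, realToComplex_tmul, realToComplex_tmul]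
      have h1 : ((r * s : ℝ) : ℂ) ⊗ₜ[ℚ] v = (s : ℂ) • ((r : ℂ) ⊗ₜ[ℚ] v) := by
        simp [TensorProduct.smul_tmul', mul_comm]
      rw [h1, TensorProduct.smul_tmul]
      simp [TensorProduct.smul_tmul']

theorem complexTensorEquiv_tensor (hV : ℂˣ →* GLReal V) (hW : ℂˣ →* GLReal W) (z : ℂˣ)
    (x : RealPoints (V ⊗[ℚ] W)) :
    complexTensorEquiv V W (realToComplex _ (tensor hV hW z x)) =
      TensorProduct.map (complexHom hV z : ComplexPoints V →ₗ[ℂ] ComplexPoints V)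
        (complexHom hW z : ComplexPoints W →ₗ[ℂ] ComplexPoints W)
        (complexTensorEquiv V W (realToComplex _ x)) := by
  obtain ⟨t, rfl⟩ := (realTensorEquiv V W).symm.surjective x
  induction t using TensorProduct.induction_on with
  | zero => simp
  | add t t' ht ht' => simp only [map_add, ht, ht']
  | tmul x y =>
    have : tensor hV hW z ((realTensorEquiv V W).symm (x ⊗ₜ y)) =
        (realTensorEquiv V W).symm (hV z x ⊗ₜ hW z y) := by
      simp [tensor]
    rw [this, complexTensorEquiv_realToComplex, complexTensorEquiv_realToComplex,
      TensorProduct.map_tmul]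
    simp [complexHom_apply, complexify_realToComplex]

/-- The complexification of `f : V → W ⊗ W`, with values in `W_ℂ ⊗ W_ℂ`. -/
def tensorComplexification (f : V →ₗ[ℚ] W ⊗[ℚ] W) :
    ComplexPoints V →ₗ[ℂ] ComplexPoints W ⊗[ℂ] ComplexPoints W :=
  (complexTensorEquiv W W).toLinearMap ∘ₗ f.baseChange ℂ

theorem IsHodgeMorphism.tensorComplexification_comp {h : ℂˣ →* GLReal V} {hW : ℂˣ →* GLReal W}
    {f : V →ₗ[ℚ] W ⊗[ℚ] W} (hf : IsHodgeMorphism h (tensor hW hW) f) (z : ℂˣ) :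
    tensorComplexification f ∘ₗ (complexHom h z : ComplexPoints V →ₗ[ℂ] ComplexPoints V) =
      TensorProduct.map (complexHom hW z : ComplexPoints W →ₗ[ℂ] ComplexPoints W)
        (complexHom hW z : ComplexPoints W →ₗ[ℂ] ComplexPoints W) ∘ₗ
        tensorComplexification f := by
  refine ext_realToComplex fun x => ?_
  simp only [tensorComplexification, LinearMap.comp_apply, LinearEquiv.coe_coe]
  rw [complexHom_apply, complexify_realToComplex, linearMap_baseChange_realToComplex, hf,
    complexTensorEquiv_tensor, linearMap_baseChange_realToComplex]

theorem tensorComplexification_injective {f : V →ₗ[ℚ] W ⊗[ℚ] W} (hf : Function.Injective f) :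
    Function.Injective (tensorComplexification f) :=
  (complexTensorEquiv W W).injective.comp (Module.Flat.lTensor_preserves_injective_linearMap f hf)

theorem IsPolarization.complexHom_equivariant {h : ℂˣ →* GLReal V} {k : ℕ}
    {Q : LinearMap.BilinForm ℚ V} (hQ : IsPolarization h k Q) (z : ℂˣ) (v w : ComplexPoints V) :
    Q.baseChange ℂ (complexHom h z v) (complexHom h z w) =
      (z * starRingEnd ℂ z : ℂ) ^ k * Q.baseChange ℂ v w := by
  have : (Q.baseChange ℂ).compl₁₂ (complexHom h z : ComplexPoints V →ₗ[ℂ] ComplexPoints V)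
      (complexHom h z : ComplexPoints V →ₗ[ℂ] ComplexPoints V) =
      ((z * starRingEnd ℂ z : ℂ) ^ k) • Q.baseChange ℂ := by
    refine ext_realToComplex fun x => ext_realToComplex fun y => ?_
    simp only [LinearMap.compl₁₂_apply, LinearEquiv.coe_coe, complexHom_apply,
      complexify_realToComplex, baseChange_realToComplex, hQ.equivariant, LinearMap.smul_apply,
      Complex.mul_conj]
    simp
  exact LinearMap.congr_fun₂ this v w

end ComplexPoints

/-! ### Descent by functionals `ℂ → ℚ`, and the endomorphisms induced through `f`. -/

section Functionals

variable {V : Type u} [AddCommGroup V] [Module ℚ V]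
variable {W : Type v} [AddCommGroup W] [Module ℚ W]

/-- The map `l ⊗ id : V_ℂ → V` for a `ℚ`-linear functional `l : ℂ → ℚ`. -/
def contract (V : Type u) [AddCommGroup V] [Module ℚ V] (l : ℂ →ₗ[ℚ] ℚ) :
    ComplexPoints V →ₗ[ℚ] V :=
  (TensorProduct.lid ℚ V).toLinearMap ∘ₗ l.rTensor V

theorem contract_tmul (l : ℂ →ₗ[ℚ] ℚ) (c : ℂ) (v : V) : contract V l (c ⊗ₜ v) = l c • v := by
  simp [contract]

theorem map_contract (l : ℂ →ₗ[ℚ] ℚ) (f : V →ₗ[ℚ] W) (x : ComplexPoints V) :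
    f (contract V l x) = contract W l (f.baseChange ℂ x) := by
  induction x using TensorProduct.induction_on with
  | zero => simp
  | add x y hx hy => simp [hx, hy]
  | tmul c v => simp [contract_tmul]

theorem repr_contract {ι : Type*} (b : Module.Basis ι ℚ V) (l : ℂ →ₗ[ℚ] ℚ) (x : ComplexPoints V)
    (i : ι) : b.repr (contract V l x) i = l ((b.baseChange ℂ).repr x i) := by
  induction x using TensorProduct.induction_on with
  | zero => simp
  | add x y hx hy => simp [hx, hy]
  | tmul c v =>
    rw [contract_tmul, Module.Basis.baseChange_repr_tmul, map_smul, map_smul]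
    simp [mul_comm]

theorem eq_zero_of_contract [FiniteDimensional ℚ V] {x : ComplexPoints V}
    (hx : ∀ l, contract V l x = 0) : x = 0 := by
  refine ((Module.finBasis ℚ V).baseChange ℂ).ext_elem fun i => ?_
  rw [map_zero, Finsupp.zero_apply]
  refine (Module.forall_dual_apply_eq_zero_iff ℚ _).1 fun l => ?_
  rw [← repr_contract, hx, map_zero, Finsupp.zero_apply]

/-- The endomorphism of `V` obtained from one of `V_ℂ` by applying a `ℚ`-linear functional
`ℂ → ℚ` to its matrix entries. -/
def contractEnd (l : ℂ →ₗ[ℚ] ℚ) (B : Module.End ℂ (ComplexPoints V)) : Module.End ℚ V :=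
  contract V l ∘ₗ B.restrictScalars ℚ ∘ₗ TensorProduct.mk ℚ ℂ V 1

theorem contractEnd_apply (l : ℂ →ₗ[ℚ] ℚ) (B : Module.End ℂ (ComplexPoints V)) (v : V) :
    contractEnd l B v = contract V l (B (1 ⊗ₜ v)) := rfl

theorem toMatrix_baseChange_contractEnd {ι : Type*} [Fintype ι] [DecidableEq ι]
    (b : Module.Basis ι ℚ V) (l : ℂ →ₗ[ℚ] ℚ)
    (B : Module.End ℂ (ComplexPoints V)) :
    LinearMap.toMatrix (b.baseChange ℂ) (b.baseChange ℂ) ((contractEnd l B).baseChange ℂ) =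
      (ratPart l (LinearMap.toMatrix (b.baseChange ℂ) (b.baseChange ℂ) B)).map
        (algebraMap ℚ ℂ) := by
  ext i j
  simp [LinearMap.toMatrix_apply, ratPart, contractEnd_apply, repr_contract]

/-- The derivation `A ⊗ 1 + 1 ⊗ A` of `M ⊗ M`. -/
def tensorDerivation {K M : Type*} [CommRing K] [AddCommGroup M] [Module K M]
    (A : Module.End K M) : Module.End K (M ⊗[K] M) :=
  TensorProduct.map A LinearMap.id + TensorProduct.map LinearMap.id A

/-- On a rational tensor each summand of the derivation leaves one factor rational, so the
functional acts only on the other factor. -/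
theorem contract_tensorDerivation (l : ℂ →ₗ[ℚ] ℚ) (A : Module.End ℂ (ComplexPoints W))
    (t : W ⊗[ℚ] W) :
    contract _ l ((complexTensorEquiv W W).symm
      (tensorDerivation A (complexTensorEquiv W W (1 ⊗ₜ t)))) =
      tensorDerivation (contractEnd l A) t := by
  have h1 : ∀ (y : ComplexPoints W) (w : W), contract _ l ((complexTensorEquiv W W).symm
      (y ⊗ₜ (1 ⊗ₜ w))) = contract W l y ⊗ₜ w := by
    intro y w
    induction y using TensorProduct.induction_on with
    | zero => simp
    | add x y hx hy => simp only [TensorProduct.add_tmul, map_add, hx, hy]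
    | tmul c v =>
      rw [complexTensorEquiv, TensorProduct.AlgebraTensorModule.distribBaseChange_symm_tmul,
        contract_tmul, contract_tmul, mul_one, TensorProduct.smul_tmul']
  have h2 : ∀ (y : ComplexPoints W) (w : W), contract _ l ((complexTensorEquiv W W).symm
      ((1 ⊗ₜ w) ⊗ₜ y)) = w ⊗ₜ contract W l y := by
    intro y w
    induction y using TensorProduct.induction_on with
    | zero => simp
    | add x y hx hy => simp only [TensorProduct.tmul_add, map_add, hx, hy]
    | tmul c v =>
      rw [complexTensorEquiv, TensorProduct.AlgebraTensorModule.distribBaseChange_symm_tmul,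
        contract_tmul, contract_tmul, one_mul, TensorProduct.tmul_smul]
  induction t using TensorProduct.induction_on with
  | zero => simp
  | add x y hx hy => simp only [TensorProduct.tmul_add, map_add, hx, hy]
  | tmul v w =>
    simp only [complexTensorEquiv_tmul, tensorDerivation, LinearMap.add_apply,
      TensorProduct.map_tmul, LinearMap.id_apply, map_add, h1, h2, contractEnd_apply]

theorem complexTensorEquiv_tensorDerivation (A : Module.End ℚ W) (t : W ⊗[ℚ] W) :
    complexTensorEquiv W W (1 ⊗ₜ tensorDerivation A t) =
      tensorDerivation (A.baseChange ℂ) (complexTensorEquiv W W (1 ⊗ₜ t)) := by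
  induction t using TensorProduct.induction_on with
  | zero => simp
  | add x y hx hy => simp only [TensorProduct.tmul_add, map_add, hx, hy]
  | tmul v w =>
    simp [complexTensorEquiv_tmul, tensorDerivation, TensorProduct.tmul_add]

/-- The endomorphisms of `V_ℂ` that are induced, along `f : V → W ⊗ W`, by the derivation
`A ⊗ 1 + 1 ⊗ A` for an endomorphism `A` of `W_ℂ`. -/
def inducedEnd (f : V →ₗ[ℚ] W ⊗[ℚ] W) : Submodule ℂ (Module.End ℂ (ComplexPoints V)) where
  carrier := {B | ∃ A : Module.End ℂ (ComplexPoints W),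
    tensorComplexification f ∘ₗ B = tensorDerivation A ∘ₗ tensorComplexification f}
  zero_mem' := ⟨0, by simp [tensorDerivation]⟩
  add_mem' := by
    rintro B B' ⟨A, hA⟩ ⟨A', hA'⟩
    refine ⟨A + A', ?_⟩
    rw [LinearMap.comp_add, hA, hA', ← LinearMap.add_comp]
    simp only [tensorDerivation, TensorProduct.map_add_left, TensorProduct.map_add_right]
    congr 1
    abel
  smul_mem' := by
    rintro c B ⟨A, hA⟩
    refine ⟨c • A, ?_⟩
    rw [LinearMap.comp_smul, hA, ← LinearMap.smul_comp]
    simp only [tensorDerivation, TensorProduct.map_smul_left, TensorProduct.map_smul_right,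
      smul_add]

/-- Apply `l` to the defining relation between `B` and `A` on rational vectors: since `f` commutes
with `l`, the same relation holds between the contracted endomorphisms. -/
theorem baseChange_contractEnd_mem_inducedEnd {f : V →ₗ[ℚ] W ⊗[ℚ] W}
    {B : Module.End ℂ (ComplexPoints V)} (hB : B ∈ inducedEnd f) (l : ℂ →ₗ[ℚ] ℚ) :
    (contractEnd l B).baseChange ℂ ∈ inducedEnd f := by
  obtain ⟨A, hA⟩ := hB
  refine ⟨(contractEnd l A).baseChange ℂ, ?_⟩
  refine TensorProduct.AlgebraTensorModule.curry_injective ?_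
  ext v
  have h1 : f (contractEnd l B v) = tensorDerivation (contractEnd l A) (f v) := by
    have h2 := congrArg (fun y => contract _ l ((complexTensorEquiv W W).symm y))
      (LinearMap.congr_fun hA (1 ⊗ₜ v))
    simp only [tensorComplexification, LinearMap.comp_apply, LinearEquiv.coe_coe,
      LinearEquiv.symm_apply_apply, LinearMap.baseChange_tmul, contract_tensorDerivation] at h2
    rw [contractEnd_apply, map_contract, h2]
  simp [tensorComplexification, h1, complexTensorEquiv_tensorDerivation]

/-- The matrices of the elements of `inducedEnd f`. -/
def inducedMatrices [FiniteDimensional ℚ V] (f : V →ₗ[ℚ] W ⊗[ℚ] W) :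
    Submodule ℂ (Matrix (Fin (Module.finrank ℚ V)) (Fin (Module.finrank ℚ V)) ℂ) :=
  (inducedEnd f).map (LinearMap.toMatrix ((Module.finBasis ℚ V).baseChange ℂ)
    ((Module.finBasis ℚ V).baseChange ℂ)).toLinearMap

theorem isRationalSubspace_inducedMatrices [FiniteDimensional ℚ V] (f : V →ₗ[ℚ] W ⊗[ℚ] W) :
    IsRationalSubspace (inducedMatrices f) := by
  rintro l _ ⟨B, hB, rfl⟩
  exact ⟨_, baseChange_contractEnd_mem_inducedEnd hB l, toMatrix_baseChange_contractEnd _ l B⟩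

theorem mem_matrixNormalizer_inducedMatrices [FiniteDimensional ℚ V] {f : V →ₗ[ℚ] W ⊗[ℚ] W}
    {g : GLComplex V} :
    g ∈ matrixNormalizer (inducedMatrices f) ↔ ∀ B ∈ inducedEnd f,
      (g : Module.End ℂ (ComplexPoints V)) * B * ((g⁻¹ : GLComplex V) :
        Module.End ℂ (ComplexPoints V)) ∈ inducedEnd f ∧
      ((g⁻¹ : GLComplex V) : Module.End ℂ (ComplexPoints V)) * B *
        (g : Module.End ℂ (ComplexPoints V)) ∈ inducedEnd f := by
  have key : ∀ B, LinearMap.toMatrix ((Module.finBasis ℚ V).baseChange ℂ)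
      ((Module.finBasis ℚ V).baseChange ℂ) B ∈ inducedMatrices f ↔ B ∈ inducedEnd f := by
    intro B
    exact Function.Injective.mem_set_image (LinearEquiv.injective _)
  constructor
  · intro hg B hB
    have h1 := hg _ ((key B).2 hB)
    simp only [rationalMatrix, ← LinearMap.toMatrix_mul] at h1
    exact ⟨(key _).1 h1.1, (key _).1 h1.2⟩
  · rintro hg _ ⟨B, hB, rfl⟩
    have h1 := hg B hB
    simp only [rationalMatrix, LinearEquiv.coe_coe, ← LinearMap.toMatrix_mul]
    exact ⟨(key _).2 h1.1, (key _).2 h1.2⟩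

end Functionals

/-! ### Brackets and conjugates of derivations of a tensor square. -/

section Bracket

variable {K M : Type*} [CommRing K] [AddCommGroup M] [Module K M]

/-- The mixed terms `A ⊗ B` and `B ⊗ A` occur in both products and cancel. -/
theorem tensorDerivation_lie (A B : Module.End K M) :
    tensorDerivation (A * B - B * A) =
      tensorDerivation A * tensorDerivation B - tensorDerivation B * tensorDerivation A := by
  refine TensorProduct.ext' fun x y => ?_
  simp only [tensorDerivation, LinearMap.add_apply, LinearMap.sub_apply, Module.End.mul_apply,
    TensorProduct.map_tmul, LinearMap.id_apply, TensorProduct.sub_tmul, TensorProduct.tmul_sub,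
    map_add]
  abel

theorem tensorDerivation_conj {G G' : Module.End K M} (hG : G * G' = 1) (A : Module.End K M) :
    tensorDerivation (G * A * G') =
      TensorProduct.map G G * tensorDerivation A * TensorProduct.map G' G' := by
  have h1 : ∀ x, G (G' x) = x := fun x => LinearMap.congr_fun hG x
  refine TensorProduct.ext' fun x y => ?_
  simp [tensorDerivation, h1]

/-- If `p` is idempotent, the eigenvalues of `ad p` are among `0, 1, -1`. -/
theorem ad_pow_three_of_isIdempotentElem {R : Type*} [Ring R] {p : R} (hp : p * p = p) (a : R) :
    p * (p * (p * a - a * p) - (p * a - a * p) * p) -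
      (p * (p * a - a * p) - (p * a - a * p) * p) * p = p * a - a * p := by
  have h1 : ∀ b, p * (p * b) = p * b := fun b => by rw [← mul_assoc, hp]
  simp only [mul_sub, sub_mul, mul_assoc, hp, h1]
  abel

end Bracket

/-! ### Unipotent isometries attached to isotropic planes. -/

section Siegel

variable {K M : Type*} [Field K] [AddCommGroup M] [Module K M]

/-- The Siegel (Eichler) transformation attached to an isotropic pair of vectors. -/
theorem exists_siegel_transformation [FiniteDimensional K M] (b : LinearMap.BilinForm K M)
    (hb : ∀ v w, b v w = b w v) {e₁ e₂ : M} (h₁₁ : b e₁ e₁ = 0) (h₁₂ : b e₁ e₂ = 0)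
    (h₂₂ : b e₂ e₂ = 0) :
    ∃ g : M ≃ₗ[K] M, (∀ v w, b (g v) (g w) = b v w) ∧ LinearEquiv.det g = 1 ∧
      ∀ v, g v = v + (b e₁ v • e₂ - b e₂ v • e₁) := by
  have h₂₁ : b e₂ e₁ = 0 := by rw [hb, h₁₂]
  have h' : (-b e₂) e₁ = 0 := by simp [h₂₁]
  -- The isometry is a product of two transvections, so its determinant is 1. The one applied first
  -- moves `v` along `e₁`, which `b e₁` does not see.
  have hg : ∀ v, (LinearEquiv.transvection h₁₂ * LinearEquiv.transvection h') v =
      v + (b e₁ v • e₂ - b e₂ v • e₁) := by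
    intro v
    simp [LinearMap.transvection.apply, h₁₁]
    abel
  refine ⟨LinearEquiv.transvection h₁₂ * LinearEquiv.transvection h', fun v w => ?_, ?_, hg⟩
  · rw [hg, hg]
    simp only [map_add, map_sub, map_smul, LinearMap.add_apply, LinearMap.sub_apply,
      LinearMap.smul_apply, smul_eq_mul, h₁₁, h₁₂, h₂₁, h₂₂, hb v e₁, hb v e₂]
    ring
  · rw [map_mul, LinearEquiv.transvection.det_eq_one, LinearEquiv.transvection.det_eq_one, one_mul]

end Siegel

/-! ### Hodge gradings in weights one and two. -/

section Weights

variable {V : Type u} [AddCommGroup V] [Module ℚ V]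
variable {W : Type v} [AddCommGroup W] [Module ℚ W]

theorem mem_hodgePart {h : ℂˣ →* GLReal V} {p q : ℕ} {v : ComplexPoints V} :
    v ∈ hodgePart h p q ↔
      ∀ z : ℂˣ, complexHom h z v = ((z : ℂ) ^ p * (starRingEnd ℂ (z : ℂ)) ^ q) • v := Iff.rfl

theorem IsHodgeStructure.ext {h : ℂˣ →* GLReal V} {k : ℕ} (hV : IsHodgeStructure h k)
    {M : Type w} [AddCommGroup M] [Module ℂ M] {f g : ComplexPoints V →ₗ[ℂ] M}
    (hfg : ∀ p q, p + q = k → ∀ v ∈ hodgePart h p q, f v = g v) : f = g := by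
  refine LinearMap.ext fun v => ?_
  have hv : v ∈ ⨆ pq : {pq : ℕ × ℕ // pq.1 + pq.2 = k}, hodgePart h pq.1.1 pq.1.2 := by
    rw [DirectSum.IsInternal.submodule_iSup_eq_top hV]
    trivial
  induction hv using Submodule.iSup_induction' with
  | mem pq v hv => exact hfg _ _ pq.2 v hv
  | zero => simp
  | add x y _ _ hx hy => rw [map_add, map_add, hx, hy]

/-- The unit `1 + i ∈ ℂ*`. -/
def unitOneAddI : ℂˣ := Units.mk0 (1 + Complex.I) fun h => by simpa using congrArg Complex.re h

theorem val_unitI : (unitI : ℂ) = Complex.I := rfl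

theorem val_unitOneAddI : (unitOneAddI : ℂ) = 1 + Complex.I := rfl

/-- For a Hodge structure of weight one, the projection onto `V^{1,0}` along `V^{0,1}`. -/
def holomorphicProjection (h : ℂˣ →* GLReal V) : Module.End ℂ (ComplexPoints V) :=
  (1 / 2 : ℂ) • 1 - (Complex.I / 2) • (complexHom h unitI : Module.End ℂ (ComplexPoints V))

theorem holomorphicProjection_apply (h : ℂˣ →* GLReal V) (v : ComplexPoints V) :
    holomorphicProjection h v = (1 / 2 : ℂ) • v - (Complex.I / 2) • complexHom h unitI v := rfl

/-- `h(i)` is `i` on `V^{1,0}` and `-i` on `V^{0,1}`, so the combination takes the values `1/2 +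
1/2` and `1/2 - 1/2`. -/
theorem holomorphicProjection_of_mem {h : ℂˣ →* GLReal V} {p q : ℕ} (hpq : p + q = 1)
    {v : ComplexPoints V} (hv : v ∈ hodgePart h p q) : holomorphicProjection h v = (p : ℂ) • v := by
  rw [holomorphicProjection_apply, mem_hodgePart.1 hv, val_unitI, smul_smul, ← sub_smul]
  congr 1
  obtain ⟨rfl, rfl⟩ | ⟨rfl, rfl⟩ : p = 0 ∧ q = 1 ∨ p = 1 ∧ q = 0 := by omega
  · simp
    linear_combination (1 / 2 : ℂ) * Complex.I_mul_I
  · simp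
    linear_combination (-1 / 2 : ℂ) * Complex.I_mul_I

theorem holomorphicProjection_mul_self {h : ℂˣ →* GLReal V} (hV : IsHodgeStructure h 1) :
    holomorphicProjection h * holomorphicProjection h = holomorphicProjection h := by
  refine hV.ext fun p q hpq v hv => ?_
  rw [Module.End.mul_apply, holomorphicProjection_of_mem hpq hv, map_smul,
    holomorphicProjection_of_mem hpq hv, smul_smul]
  obtain rfl | rfl : p = 0 ∨ p = 1 := by omega
  · simp
  · simp

theorem complexHom_eq_holomorphicProjection {h : ℂˣ →* GLReal V} (hV : IsHodgeStructure h 1)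
    (z : ℂˣ) : (complexHom h z : Module.End ℂ (ComplexPoints V)) =
      (z : ℂ) • holomorphicProjection h +
        starRingEnd ℂ (z : ℂ) • (1 - holomorphicProjection h) := by
  refine hV.ext fun p q hpq v hv => ?_
  rw [LinearEquiv.coe_coe, mem_hodgePart.1 hv, LinearMap.add_apply, LinearMap.smul_apply,
    LinearMap.smul_apply, LinearMap.sub_apply, holomorphicProjection_of_mem hpq hv]
  obtain ⟨rfl, rfl⟩ | ⟨rfl, rfl⟩ : p = 0 ∧ q = 1 ∨ p = 1 ∧ q = 0 := by omega
  · simp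
  · simp

/-- For a Hodge structure of weight two, the endomorphism that is multiplication by `p`
on `V^{p,q}`. -/
def gradingEnd (h : ℂˣ →* GLReal V) : Module.End ℂ (ComplexPoints V) :=
  ((2 + Complex.I) / 2) • 1 +
    (Complex.I / 2) • (complexHom h unitI : Module.End ℂ (ComplexPoints V)) -
    (Complex.I / 2) • (complexHom h unitOneAddI : Module.End ℂ (ComplexPoints V))

/-- For `p = 0, 1, 2` the operator `h(i)` acts by `-1, 1, -1` and `h(1 + i)` by `-2i, 2, 2i`. The
coefficients of `gradingEnd` are the unique solution interpolating the values `0, 1, 2`. -/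
theorem gradingEnd_of_mem {h : ℂˣ →* GLReal V} {p q : ℕ} (hpq : p + q = 2)
    {v : ComplexPoints V} (hv : v ∈ hodgePart h p q) : gradingEnd h v = (p : ℂ) • v := by
  simp only [gradingEnd, LinearMap.sub_apply, LinearMap.add_apply, LinearMap.smul_apply,
    LinearEquiv.coe_coe, Module.End.one_apply]
  rw [mem_hodgePart.1 hv, mem_hodgePart.1 hv, val_unitI, val_unitOneAddI, smul_smul, smul_smul,
    ← add_smul, ← sub_smul]
  congr 1
  have hI := Complex.I_mul_I
  obtain ⟨rfl, rfl⟩ | ⟨rfl, rfl⟩ | ⟨rfl, rfl⟩ :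
      p = 0 ∧ q = 2 ∨ p = 1 ∧ q = 1 ∨ p = 2 ∧ q = 0 := by omega
  · simp
    linear_combination (1 - Complex.I / 2) * hI
  · simp
    linear_combination (Complex.I / 2) * hI
  · simp
    linear_combination (-1 - Complex.I / 2) * hI

/-- `gradingEnd` is a fixed combination of the identity, `h(i)` and `h(1 + i)`. Through `f` it
becomes the same combination on `W_ℂ ⊗ W_ℂ`; writing `h_W(z) = z π + z̄ (1 - π)` turns that into `π
⊗ 1 + 1 ⊗ π`. -/
theorem tensorComplexification_comp_gradingEnd {h : ℂˣ →* GLReal V} {hW : ℂˣ →* GLReal W}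
    (hW1 : IsHodgeStructure hW 1) {f : V →ₗ[ℚ] W ⊗[ℚ] W}
    (hf : IsHodgeMorphism h (tensor hW hW) f) :
    tensorComplexification f ∘ₗ gradingEnd h =
      tensorDerivation (holomorphicProjection hW) ∘ₗ tensorComplexification f := by
  simp only [gradingEnd, LinearMap.comp_sub, LinearMap.comp_add, LinearMap.comp_smul,
    hf.tensorComplexification_comp]
  have h1 : tensorComplexification f ∘ₗ (1 : Module.End ℂ (ComplexPoints V)) =
      LinearMap.id ∘ₗ tensorComplexification f := rfl
  rw [h1]
  simp only [← LinearMap.smul_comp, ← LinearMap.add_comp, ← LinearMap.sub_comp]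
  congr 1
  refine TensorProduct.ext' fun x y => ?_
  simp only [complexHom_eq_holomorphicProjection hW1, val_unitI, val_unitOneAddI]
  simp only [tensorDerivation, LinearMap.add_apply, LinearMap.sub_apply, LinearMap.smul_apply,
    TensorProduct.map_tmul, Module.End.one_apply, LinearMap.id_apply, TensorProduct.add_tmul,
    TensorProduct.tmul_add, TensorProduct.sub_tmul, TensorProduct.tmul_sub, TensorProduct.tmul_smul,
    ← TensorProduct.smul_tmul', Complex.conj_I, map_add, map_one]
  match_scalars
  · linear_combination Complex.I_mul_I
  · ring
  · linear_combination -Complex.I_mul_I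
  · linear_combination -Complex.I_mul_I

theorem complexHom_mem_matrixNormalizer [FiniteDimensional ℚ V] {h : ℂˣ →* GLReal V}
    {hW : ℂˣ →* GLReal W} {f : V →ₗ[ℚ] W ⊗[ℚ] W} (hf : IsHodgeMorphism h (tensor hW hW) f)
    (z : ℂˣ) : complexHom h z ∈ matrixNormalizer (inducedMatrices f) := by
  -- If `A` induces `B`, then the conjugate of `A` by `h_W(z)` induces the conjugate of `B` by
  -- `h(z)`.
  have key : ∀ (z : ℂˣ), ∀ B ∈ inducedEnd f,
      (complexHom h z : Module.End ℂ (ComplexPoints V)) * B *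
        (complexHom h z⁻¹ : Module.End ℂ (ComplexPoints V)) ∈ inducedEnd f := by
    rintro z B ⟨A, hA⟩
    have hz : (complexHom hW z : Module.End ℂ (ComplexPoints W)) *
        (complexHom hW z⁻¹ : Module.End ℂ (ComplexPoints W)) = 1 := by
      rw [map_inv]
      exact LinearMap.ext fun x => LinearEquiv.apply_symm_apply (complexHom hW z) x
    refine ⟨(complexHom hW z : Module.End ℂ (ComplexPoints W)) * A *
      (complexHom hW z⁻¹ : Module.End ℂ (ComplexPoints W)), ?_⟩
    rw [tensorDerivation_conj hz]
    simp only [Module.End.mul_eq_comp, ← LinearMap.comp_assoc]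
    rw [hf.tensorComplexification_comp]
    simp only [LinearMap.comp_assoc]
    rw [← hf.tensorComplexification_comp, ← LinearMap.comp_assoc _ B, hA]
    simp only [LinearMap.comp_assoc]
  rw [mem_matrixNormalizer_inducedMatrices]
  intro B hB
  have h1 := key z B hB
  have h2 := key z⁻¹ B hB
  rw [inv_inv] at h2
  rw [map_inv] at h1 h2
  exact ⟨h1, h2⟩

/-- By minimality: the normalizer is one of the algebraic groups over `ℚ` containing `h(ℂ*)`. -/
theorem mumfordTate_le_matrixNormalizer [FiniteDimensional ℚ V] {h : ℂˣ →* GLReal V}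
    {hW : ℂˣ →* GLReal W} {f : V →ₗ[ℚ] W ⊗[ℚ] W} (hf : IsHodgeMorphism h (tensor hW hW) f) :
    mumfordTate h ≤ matrixNormalizer (inducedMatrices f) :=
  sInf_le ⟨isAlgebraicOverRat_matrixNormalizer (isRationalSubspace_inducedMatrices f),
    complexHom_mem_matrixNormalizer hf⟩

/-- The weights of the elements of `inducedEnd f` are among `0, 1, -1`. -/
theorem ad_pow_three_of_mem_inducedEnd {h : ℂˣ →* GLReal V} {hW : ℂˣ →* GLReal W}
    (hW1 : IsHodgeStructure hW 1) {f : V →ₗ[ℚ] W ⊗[ℚ] W} (hf : Function.Injective f)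
    (hfh : IsHodgeMorphism h (tensor hW hW) f) {B : Module.End ℂ (ComplexPoints V)}
    (hB : B ∈ inducedEnd f) :
    gradingEnd h * (gradingEnd h * (gradingEnd h * B - B * gradingEnd h) -
        (gradingEnd h * B - B * gradingEnd h) * gradingEnd h) -
      (gradingEnd h * (gradingEnd h * B - B * gradingEnd h) -
        (gradingEnd h * B - B * gradingEnd h) * gradingEnd h) * gradingEnd h =
      gradingEnd h * B - B * gradingEnd h := by
  obtain ⟨A, hA⟩ := hB
  have hμ := tensorComplexification_comp_gradingEnd hW1 hfh
  set μ := gradingEnd h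
  set p := holomorphicProjection hW
  -- Through `f`, `ad μ` on `V_ℂ` corresponds to `ad p` on `W_ℂ`. Applied three times, it carries
  -- the cubic identity for the idempotent `p` over to `μ`, where injectivity of `f` cancels `f`.
  have key : ∀ A B, tensorComplexification f ∘ₗ B = tensorDerivation A ∘ₗ tensorComplexification f →
      tensorComplexification f ∘ₗ (μ * B - B * μ) =
        tensorDerivation (p * A - A * p) ∘ₗ tensorComplexification f := by
    intro A B hAB
    have hμ' := LinearMap.congr_fun hμ
    have hAB' := LinearMap.congr_fun hAB
    simp only [LinearMap.comp_apply] at hμ' hAB'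
    rw [tensorDerivation_lie]
    ext v
    simp [hμ', hAB']
  have h1 := key _ _ hA
  have h3 := key _ _ (key _ _ h1)
  rw [ad_pow_three_of_isIdempotentElem (holomorphicProjection_mul_self hW1), ← h1] at h3
  exact LinearMap.ext fun v => tensorComplexification_injective hf (LinearMap.congr_fun h3 v)

end Weights

/-! ### Consequences of the polarization, and the bound on `V^{2,0}`. -/

section Polarization

variable {V : Type u} [AddCommGroup V] [Module ℚ V]

/-- In weight two `h(i)` is an involution preserving `Q`, so `Q(v, w) = Q(v, h(i)h(i)w) = Q(h(i)w,
h(i)v) = Q(w, v)`. -/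
theorem IsPolarization.baseChange_comm {h : ℂˣ →* GLReal V} {Q : LinearMap.BilinForm ℚ V}
    (hV : IsHodgeStructure h 2) (hQ : IsPolarization h 2 Q) (v w : ComplexPoints V) :
    Q.baseChange ℂ v w = Q.baseChange ℂ w v := by
  have h1 : ∀ v w, Q.baseChange ℂ v (complexHom h unitI w) =
      Q.baseChange ℂ w (complexHom h unitI v) := by
    have : (Q.baseChange ℂ).compl₁₂ LinearMap.id
        (complexHom h unitI : ComplexPoints V →ₗ[ℂ] ComplexPoints V) =
        ((Q.baseChange ℂ).compl₁₂ LinearMap.id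
          (complexHom h unitI : ComplexPoints V →ₗ[ℂ] ComplexPoints V)).flip := by
      refine ext_realToComplex fun x => ext_realToComplex fun y => ?_
      simp only [LinearMap.flip_apply, LinearMap.compl₁₂_apply, LinearEquiv.coe_coe,
        complexHom_apply, complexify_realToComplex, baseChange_realToComplex, hQ.symm x y,
        LinearMap.id_apply]
    exact fun v w => LinearMap.congr_fun₂ this v w
  have h2 : ∀ w, complexHom h unitI (complexHom h unitI w) = w := by
    have : (complexHom h unitI : ComplexPoints V →ₗ[ℂ] ComplexPoints V) ∘ₗ
        (complexHom h unitI : ComplexPoints V →ₗ[ℂ] ComplexPoints V) = LinearMap.id := by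
      refine hV.ext fun p q hpq v hv => ?_
      rw [LinearMap.comp_apply, LinearEquiv.coe_coe, mem_hodgePart.1 hv, map_smul,
        mem_hodgePart.1 hv, smul_smul, LinearMap.id_apply, val_unitI]
      obtain ⟨rfl, rfl⟩ | ⟨rfl, rfl⟩ | ⟨rfl, rfl⟩ :
        p = 0 ∧ q = 2 ∨ p = 1 ∧ q = 1 ∨ p = 2 ∧ q = 0 := by omega
      all_goals simp
    exact fun w => LinearMap.congr_fun this w
  conv_lhs => rw [← h2 w, h1, hQ.complexHom_equivariant]
  simp [val_unitI]

/-- Each contraction of `e` is a rational vector in the radical of `Q`, hence zero by positivity of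
`Q(·, h(i)·)` on `V_ℝ`. -/
theorem IsPolarization.eq_zero_of_baseChange [FiniteDimensional ℚ V] {h : ℂˣ →* GLReal V} {k : ℕ}
    {Q : LinearMap.BilinForm ℚ V} (hQ : IsPolarization h k Q) {e : ComplexPoints V}
    (he : ∀ v, Q.baseChange ℂ e v = 0) : e = 0 := by
  refine eq_zero_of_contract fun l => ?_
  have h1 : ∀ (x : ComplexPoints V) (v : V),
      Q (contract V l x) v = l (Q.baseChange ℂ x (1 ⊗ₜ v)) := by
    intro x v
    induction x using TensorProduct.induction_on with
    | zero => simp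
    | add x y hx hy => simp only [map_add, LinearMap.add_apply, hx, hy]
    | tmul c w => simp [contract_tmul, mul_comm]
  have h2 : ∀ v, Q (contract V l e) v = 0 := fun v => by rw [h1, he, map_zero]
  have h3 : ∀ y, Q.baseChange ℝ (1 ⊗ₜ contract V l e) y = 0 := by
    intro y
    induction y using TensorProduct.induction_on with
    | zero => simp
    | add x y hx hy => rw [map_add, hx, hy, add_zero]
    | tmul c w => simp [h2]
  have h4 : (1 : ℝ) ⊗ₜ[ℚ] contract V l e = 0 := by
    by_contra hne
    exact (hQ.pos _ hne).ne' (h3 _)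
  refine Module.FaithfullyFlat.tensorProduct_mk_injective (A := ℚ) (B := ℝ) V ?_
  simpa using h4

/-- Equivariance at `z = 1 + i` multiplies `Q(e, v)` by `4` on one side and by `4i` (for `p = 1`) or
`-4` (for `p = 2`) on the other. Only `V^{0,2}` can pair nontrivially with `V^{2,0}`. -/
theorem IsPolarization.baseChange_eq_zero {h : ℂˣ →* GLReal V} {Q : LinearMap.BilinForm ℚ V}
    (hQ : IsPolarization h 2 Q) {p q : ℕ} (hpq : p + q = 2) (hp : p ≠ 0) {e v : ComplexPoints V}
    (he : e ∈ hodgePart h 2 0) (hv : v ∈ hodgePart h p q) : Q.baseChange ℂ e v = 0 := by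
  have h1 := hQ.complexHom_equivariant unitOneAddI e v
  rw [mem_hodgePart.1 he, mem_hodgePart.1 hv, val_unitOneAddI] at h1
  simp only [map_smul, LinearMap.smul_apply, smul_eq_mul] at h1
  have hI := Complex.I_mul_I
  have h2 : (1 + Complex.I) * (1 + -Complex.I) = 2 := by linear_combination -hI
  have h3 : (1 + Complex.I) ^ 2 = 2 * Complex.I := by linear_combination hI
  obtain ⟨rfl, rfl⟩ | ⟨rfl, rfl⟩ : p = 1 ∧ q = 1 ∨ p = 2 ∧ q = 0 := by omega
  · simp only [pow_one, pow_zero, mul_one, map_add, map_one, Complex.conj_I, h2, h3] at h1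
    linear_combination (-(1 + Complex.I) / 8) * h1 + (1 / 2 * Q.baseChange ℂ e v) * hI
  · simp only [pow_zero, mul_one, map_add, map_one, Complex.conj_I, h2, h3] at h1
    linear_combination (-1 / 8 : ℂ) * h1 + (1 / 2 * Q.baseChange ℂ e v) * hI

theorem finrank_hodgePart_le_one [FiniteDimensional ℚ V] {h : ℂˣ →* GLReal V}
    {Q : LinearMap.BilinForm ℚ V} (hV : IsHodgeStructure h 2) (hQ : IsPolarization h 2 Q)
    (hMT : SO Q ≤ mumfordTate h) {W : Type v} [AddCommGroup W] [Module ℚ W]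
    {hW : ℂˣ →* GLReal W} (hW1 : IsHodgeStructure hW 1) {f : V →ₗ[ℚ] W ⊗[ℚ] W}
    (hf : Function.Injective f) (hfh : IsHodgeMorphism h (tensor hW hW) f) :
    Module.finrank ℂ (hodgePart h 2 0) ≤ 1 := by
  by_contra! hlt
  obtain ⟨⟨e₁, he₁⟩, hne⟩ : ∃ e : hodgePart h 2 0, e ≠ 0 := by
    have := Module.nontrivial_of_finrank_pos (R := ℂ) (zero_lt_one.trans hlt)
    exact exists_ne 0
  obtain ⟨⟨e₂, he₂⟩, hind⟩ := exists_linearIndependent_pair_of_one_lt_finrank hlt hne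
  have hiso : ∀ {e e'}, e ∈ hodgePart h 2 0 → e' ∈ hodgePart h 2 0 → Q.baseChange ℂ e e' = 0 :=
    fun he he' => hQ.baseChange_eq_zero rfl two_ne_zero he he'
  obtain ⟨g, hg, hdet, hgx⟩ := exists_siegel_transformation (Q.baseChange ℂ)
    (hQ.baseChange_comm hV) (hiso he₁ he₁) (hiso he₁ he₂) (hiso he₂ he₂)
  let x : Module.End ℂ (ComplexPoints V) :=
    (Q.baseChange ℂ e₁).smulRight e₂ - (Q.baseChange ℂ e₂).smulRight e₁
  have hx : ∀ v, x v = Q.baseChange ℂ e₁ v • e₂ - Q.baseChange ℂ e₂ v • e₁ := fun v => rfl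
  have hxmem : ∀ v, x v ∈ hodgePart h 2 0 := fun v =>
    sub_mem (Submodule.smul_mem _ _ he₂) (Submodule.smul_mem _ _ he₁)
  have hxx : x * x = 0 := by
    refine LinearMap.ext fun v => ?_
    rw [Module.End.mul_apply, hx (x v), hiso he₁ (hxmem v), hiso he₂ (hxmem v)]
    simp
  have hμx : gradingEnd h * x = (2 : ℂ) • x := by
    refine LinearMap.ext fun v => ?_
    rw [Module.End.mul_apply, gradingEnd_of_mem rfl (hxmem v)]
    simp
  -- `μ` vanishes on `V^{0,2}`, and `x` kills `V^{1,1}` and `V^{2,0}` by orthogonality.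
  have hxμ : x * gradingEnd h = 0 := by
    refine hV.ext fun p q hpq v hv => ?_
    rw [Module.End.mul_apply, gradingEnd_of_mem hpq hv, map_smul, hx]
    by_cases hp : p = 0
    · simp [hp]
    · simp [hQ.baseChange_eq_zero hpq hp he₁ hv, hQ.baseChange_eq_zero hpq hp he₂ hv]
  have hg1 : (g : Module.End ℂ (ComplexPoints V)) = 1 + x := LinearMap.ext hgx
  have hg2 : ((g⁻¹ : GLComplex V) : Module.End ℂ (ComplexPoints V)) = 1 - x := by
    refine LinearMap.ext fun v => (LinearEquiv.symm_apply_eq g).2 ?_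
    have h1 : (1 + x) * (1 - x) = 1 := by
      rw [mul_sub, mul_one, add_mul, one_mul, hxx]
      simp
    have h2 := LinearMap.congr_fun h1 v
    rw [← hg1] at h2
    exact h2.symm
  -- The hypothesis on the Mumford–Tate group enters here: `g = 1 + x` lies in `SO(Q)`, hence
  -- normalizes `inducedEnd f`, which contains `μ`.
  have hconj : (1 + x) * gradingEnd h * (1 - x) ∈ inducedEnd f := by
    rw [← hg1, ← hg2]
    exact (mem_matrixNormalizer_inducedMatrices.1
      (mumfordTate_le_matrixNormalizer hfh (hMT ⟨hg, hdet⟩)) _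
      ⟨_, tensorComplexification_comp_gradingEnd hW1 hfh⟩).1
  have hB : (1 + x) * gradingEnd h * (1 - x) = gradingEnd h - (2 : ℂ) • x := by
    rw [add_mul, one_mul, hxμ, add_zero, mul_sub, mul_one, hμx]
  have had := ad_pow_three_of_mem_inducedEnd hW1 hf hfh hconj
  rw [hB] at had
  -- On `μ - 2x`, `ad μ` gives `-4x` and `(ad μ)³` gives `-16x`; equality of the two forces `x = 0`.
  have hx0 : x = 0 := by
    have hc : ∀ c : ℂ, gradingEnd h * (c • x) - (c • x) * gradingEnd h = (c * 2) • x := by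
      intro c
      rw [mul_smul_comm, smul_mul_assoc, hμx, hxμ, smul_zero, sub_zero, smul_smul]
    have hc' : gradingEnd h * (gradingEnd h - (2 : ℂ) • x) -
        (gradingEnd h - (2 : ℂ) • x) * gradingEnd h = (-4 : ℂ) • x := by
      rw [mul_sub, sub_mul, sub_sub_sub_cancel_left, ← neg_sub, hc]
      module
    rw [hc', hc, hc] at had
    refine LinearMap.ext fun v => ?_
    have hv := LinearMap.congr_fun had v
    rw [LinearMap.smul_apply, LinearMap.smul_apply, ← sub_eq_zero, ← sub_smul] at hv
    exact (smul_eq_zero.1 hv).resolve_left (by norm_num)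
  -- As `e₁, e₂` are independent, `x v = 0` gives `Q(e₁, v) = 0` for every `v`, so nondegeneracy
  -- kills `e₁`.
  refine hne (Subtype.ext (hQ.eq_zero_of_baseChange fun v => ?_))
  have hv : Q.baseChange ℂ e₁ v • e₂ - Q.baseChange ℂ e₂ v • e₁ = 0 := by rw [← hx, hx0]; rfl
  rw [LinearIndependent.pair_iff] at hind
  refine (hind (-Q.baseChange ℂ e₂ v) (Q.baseChange ℂ e₁ v) (Subtype.ext (Eq.trans ?_ hv))).2
  simp
  abel

end Polarization

end

end Hodge

theorem proposition4p2
    {V : Type*} [AddCommGroup V] [Module ℚ V] [FiniteDimensional ℚ V]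
    (h : ℂˣ →* Hodge.GLReal V) (Q : LinearMap.BilinForm ℚ V)
    (hV : Hodge.IsHodgeStructure h 2) (hQ : Hodge.IsPolarization h 2 Q)
    (h20 : 0 < Module.finrank ℂ (Hodge.hodgePart h 2 0))
    (hMT : Hodge.mumfordTate h = Hodge.GO Q ∨ Hodge.mumfordTate h = Hodge.GSO Q)
    {W : Type*} [AddCommGroup W] [Module ℚ W] [FiniteDimensional ℚ W]
    (hW : ℂˣ →* Hodge.GLReal W) (hW1 : Hodge.IsHodgeStructure hW 1)
    (f : V →ₗ[ℚ] W ⊗[ℚ] W) (hf : Function.Injective f)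
    (hfh : Hodge.IsHodgeMorphism h (Hodge.tensor hW hW) f) :
    Module.finrank ℂ (Hodge.hodgePart h 2 0) = 1 := by
  refine le_antisymm (Hodge.finrank_hodgePart_le_one hV hQ ?_ hW1 hf hfh) h20
  -- Both candidate groups contain `SO(Q)`, with multiplier 1 or scalar 1, and this inclusion is all
  -- that the bound requires.
  intro g hg
  rcases hMT with hMT | hMT <;> rw [hMT]
  · exact ⟨1, fun v w => by rw [hg.1, Units.val_one, one_mul]⟩
  · exact ⟨1, g, hg, fun v => by simp⟩
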